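/- Let $E$ be a complex Banach lattice, i.e. the complexification $E = X \oplus iX$ of a real Banach lattice $X$, with modulus $|x+iy| = \sup_{\theta\in\mathbb{R}} \big((\cos\theta)\,x + (\sin\theta)\,y\big)$ and norm $\|z\| = \|\,|z|\,\|$. Let $T : E \to E$ be a bounded $\mathbb{C}$-linear operator which is positive (that is, $Tx \ge 0$ for every $x \ge 0$), and suppose that its spectral radius is $r(T) = 1$. Let $\lambda \in \sigma(T)$ with $|\lambda| = r(T) = 1$ be an eigenvalue of $T$, and let $z \in E$ be a corresponding eigenvector with $\|z\| = 1$. Let $(r_n)$ be a decreasing sequence of real numbers $r_n > 1$ with $r_n \to 1$. Write $R(r,T) = (r-T)^{-1}$, and for sequences of non-negative real numbers write $a_n \sim b_n$ if $a_n = O(b_n)$ and $b_n = O(a_n)$ as $n \to \infty$. Then the following holds. (a) For every $n$, $$\frac{1}{r_n-1} \;\le\; \big\|R(r_n,T)|z|\big\| \;\le\; \|R(r_n,T)\|.$$ (b) If $\big\|R(r_n,T)|z|\big\| \sim \frac{1}{r_n-1}$, then $\lambda^k \in \sigma(T)$ for all $k \in \mathbb{Z}$. (c) If $\big\|R(r_n,T)|z|\big\|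 \sim \|R(r_n,T)\|$, then $\lambda^k \in \sigma(T)$ for all $k \in \mathbb{Z}$. -/

import Mathlib

open Filter Topology Asymptotics

section Modulus

theorem smul_le_smul_abs_of_abs_le {X : Type*} [NormedAddCommGroup X] [Lattice X]
    [IsOrderedAddMonoid X] [NormedSpace ℝ X] [IsOrderedModule ℝ X] {c ε : ℝ} (h : |c| ≤ ε) (x : X) : c • x ≤ ε • |x| := by
  have h1 : |c| • |x| ≤ ε • |x| := smul_le_smul_of_nonneg_right h (abs_nonneg x)
  refine le_trans ?_ h1
  rcases le_total 0 c with hc | hc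
  · rw [abs_of_nonneg hc]
    exact smul_le_smul_of_nonneg_left (le_abs_self x) hc
  · rw [abs_of_nonpos hc]
    have h2 : (-c) • (-x) ≤ (-c) • |x| :=
      smul_le_smul_of_nonneg_left (neg_le_abs x) (neg_nonneg.2 hc)
    rwa [neg_smul_neg] at h2

variable {X : Type*} [NormedAddCommGroup X] [Lattice X] [IsOrderedAddMonoid X] [HasSolidNorm X]
  [NormedSpace ℝ X] [IsOrderedModule ℝ X]

/-- In a real Banach lattice the supremum of all `cos θ • x + sin θ • y`, `θ ∈ ℝ`, exists. -/
theorem exists_isLUB_cos_add_sin [CompleteSpace X] (x y : X) :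
    ∃ m : X, IsLUB (Set.range fun θ : ℝ => Real.cos θ • x + Real.sin θ • y) m := by
  set f : ℝ → X := fun θ => Real.cos θ • x + Real.sin θ • y with hf
  set u : X := |x| + |y| with hu
  have hu0 : 0 ≤ u := add_nonneg (abs_nonneg x) (abs_nonneg y)
  have net : ∀ ε : ℝ, 0 < ε → ∃ F : Finset ℝ, F.Nonempty ∧
      ∀ θ : ℝ, ∃ φ ∈ F, f θ ≤ f φ + ε • u := by
    intro ε hε
    have hb : TotallyBounded (Set.range fun θ : ℝ => (Real.cos θ, Real.sin θ)) := by
      refine (isCompact_closedBall (0 : ℝ × ℝ) 1).totallyBounded.subset ?_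
      rintro _ ⟨θ, rfl⟩
      simp [Prod.norm_def, Real.abs_cos_le_one, Real.abs_sin_le_one]
    obtain ⟨t, hts, htf, htc⟩ := Metric.finite_approx_of_totallyBounded hb ε hε
    classical
    have hts' : ∀ p : ℝ × ℝ, ∃ θ : ℝ, p ∈ t → (Real.cos θ, Real.sin θ) = p := by
      intro p
      by_cases hp : p ∈ t
      · obtain ⟨θ, h⟩ := hts hp
        exact ⟨θ, fun _ => h⟩
      · exact ⟨0, fun h => absurd h hp⟩
    choose g hg using hts'
    have key : ∀ θ : ℝ, ∃ φ ∈ htf.toFinset.image g, f θ ≤ f φ + ε • u := by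
      intro θ
      obtain ⟨p, hp, hpd⟩ := Set.mem_iUnion₂.1 (htc ⟨θ, rfl⟩)
      refine ⟨g p, Finset.mem_image_of_mem g (htf.mem_toFinset.2 hp), ?_⟩
      rw [← hg p hp, Metric.mem_ball, Prod.dist_eq, max_lt_iff, Real.dist_eq, Real.dist_eq] at hpd
      have h1 := smul_le_smul_abs_of_abs_le hpd.1.le x
      have h2 := smul_le_smul_abs_of_abs_le hpd.2.le y
      have h3 := add_le_add_right (add_le_add h1 h2) (f (g p))
      calc f θ = f (g p) + ((Real.cos θ - Real.cos (g p)) • x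
              + (Real.sin θ - Real.sin (g p)) • y) := by
            simp only [hf, sub_smul]; abel
        _ ≤ f (g p) + (ε • |x| + ε • |y|) := h3
        _ = f (g p) + ε • u := by rw [hu, smul_add]
    obtain ⟨φ, hφ, -⟩ := key 0
    exact ⟨_, ⟨φ, hφ⟩, key⟩
  choose F hFne hF using fun n : ℕ => net (1 / ((n : ℝ) + 1)) Nat.one_div_pos_of_nat
  set S : ℕ → X := fun n => (F n).sup' (hFne n) f with hS
  have hfS : ∀ n θ, f θ ≤ S n + (1 / ((n : ℝ) + 1)) • u := by
    intro n θ
    obtain ⟨φ, hφ, h⟩ := hF n θ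
    exact h.trans (by gcongr; exact Finset.le_sup' f hφ)
  have hSS : ∀ m n, S m ≤ S n + (1 / ((n : ℝ) + 1)) • u := fun m n =>
    Finset.sup'_le _ _ fun θ _ => hfS n θ
  have hlim : Tendsto (fun n : ℕ => (1 / ((n : ℝ) + 1))) atTop (𝓝 0) :=
    tendsto_one_div_add_atTop_nhds_zero_nat
  have hC : CauchySeq S := by
    refine cauchySeq_of_le_tendsto_0 (fun n : ℕ => (1 / ((n : ℝ) + 1)) * ‖u‖) ?_ ?_
    · intro n m N hn hm
      have mono : ∀ k : ℕ, N ≤ k → (1 / ((k : ℝ) + 1)) • u ≤ (1 / ((N : ℝ) + 1)) • u :=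
        fun k hk => smul_le_smul_of_nonneg_right (Nat.one_div_le_one_div hk) hu0
      have h1 : S n - S m ≤ (1 / ((N : ℝ) + 1)) • u :=
        sub_le_iff_le_add'.2 ((hSS n m).trans (add_le_add_right (mono m hm) _))
      have h2 : S m - S n ≤ (1 / ((N : ℝ) + 1)) • u :=
        sub_le_iff_le_add'.2 ((hSS m n).trans (add_le_add_right (mono n hn) _))
      have hpos : 0 ≤ (1 / ((N : ℝ) + 1)) := Nat.one_div_pos_of_nat.le
      have h3 : |S n - S m| ≤ |(1 / ((N : ℝ) + 1)) • u| := by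
        rw [abs_of_nonneg (smul_nonneg hpos hu0)]
        exact abs_le'.2 ⟨h1, by rwa [neg_sub]⟩
      have h4 := norm_le_norm_of_abs_le_abs h3
      rwa [norm_smul, Real.norm_of_nonneg hpos, ← dist_eq_norm] at h4
    · simpa using hlim.mul_const ‖u‖
  obtain ⟨m, hm⟩ := cauchySeq_tendsto_of_complete hC
  refine ⟨m, ?_, fun b hb => le_of_tendsto' hm fun n => Finset.sup'_le _ _ fun θ _ => hb ⟨θ, rfl⟩⟩
  rintro _ ⟨θ, rfl⟩
  have h1 : Tendsto (fun n : ℕ => S n + (1 / ((n : ℝ) + 1)) • u) atTop (𝓝 m) := by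
    simpa using hm.add (hlim.smul_const u)
  exact ge_of_tendsto' h1 fun n => hfS n θ

/-- The modulus `|x + i y| = sup_θ (cos θ • x + sin θ • y)` of the element `x + i y` of the
complexification of a real Banach lattice. -/
noncomputable def complexModulus [CompleteSpace X] (x y : X) : X :=
  Classical.choose (exists_isLUB_cos_add_sin x y)

theorem isLUB_complexModulus [CompleteSpace X] (x y : X) :
    IsLUB (Set.range fun θ : ℝ => Real.cos θ • x + Real.sin θ • y) (complexModulus x y) :=
  Classical.choose_spec (exists_isLUB_cos_add_sin x y)

end Modulus

/-- `E` is a complex Banach lattice with real part `X`: the complex normed space `E` is the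
complexification `X ⊕ i X` of the real Banach lattice `X`, and `‖z‖ = ‖ |z| ‖`. -/
structure ComplexBanachLattice (X E : Type*) [NormedAddCommGroup X] [Lattice X]
    [IsOrderedAddMonoid X] [HasSolidNorm X] [NormedSpace ℝ X] [IsOrderedModule ℝ X]
    [CompleteSpace X] [NormedAddCommGroup E] [NormedSpace ℂ E] where
  /-- `(x, y) ↦ x + i y` -/
  equiv : (X × X) ≃ₗ[ℝ] E
  I_smul_equiv : ∀ x y : X, Complex.I • equiv (x, y) = equiv (-y, x)
  norm_equiv : ∀ x y : X, ‖equiv (x, y)‖ = ‖complexModulus x y‖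

namespace ComplexBanachLattice

variable {X E : Type*} [NormedAddCommGroup X] [Lattice X]
    [IsOrderedAddMonoid X] [HasSolidNorm X] [NormedSpace ℝ X] [IsOrderedModule ℝ X]
    [CompleteSpace X] [NormedAddCommGroup E] [NormedSpace ℂ E]

/-- The inclusion of the real part. -/
noncomputable def ofReal (L : ComplexBanachLattice X E) (x : X) : E := L.equiv (x, 0)

/-- The real part of an element. -/
noncomputable def re (L : ComplexBanachLattice X E) (z : E) : X := (L.equiv.symm z).1

/-- The imaginary part of an element. -/
noncomputable def im (L : ComplexBanachLattice X E) (z : E) : X := (L.equiv.symm z).2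

/-- The modulus `|z|`, as an element of `E`. -/
noncomputable def modulus (L : ComplexBanachLattice X E) (z : E) : E :=
  L.ofReal (complexModulus (L.re z) (L.im z))

/-- The positive cone `E₊`. -/
def posCone (L : ComplexBanachLattice X E) : Set E := L.ofReal '' {x : X | 0 ≤ x}

/-- `T E₊ ⊆ E₊` -/
def IsPositive (L : ComplexBanachLattice X E) (T : E →L[ℂ] E) : Prop :=
  Set.MapsTo T L.posCone L.posCone

end ComplexBanachLattice

/-- Spectral values whose modulus is the spectral radius. -/
def peripheralSpectrum {E : Type*} [NormedAddCommGroup E] [NormedSpace ℂ E] (T : E →L[ℂ] E) :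
    Set ℂ :=
  {μ | μ ∈ spectrum ℂ T ∧ (‖μ‖₊ : ENNReal) = spectralRadius ℂ T}

/-!
Let `u = |z|`. Positivity gives `|T v| ≤ T |v|`, hence `u ≤ T ^ n u`, and the Neumann series of the
resolvent yields `u / (s - 1) ≤ R(s, T) u` for `s > 1`; this is the lower bound for the norms.

For the powers of `λ`, one would like `w = u sgn(z) ^ k` to be an eigenvector for `λ ^ k`, which
holds when `T u = u` but not in general. The substitute is an approximate power
(`exists_absVal_sub_zpow_smul_le`): a `w` such that for all unimodular `ζ`
`|w - ζ ^ k u| ≤ ε u + C (u - re (ζ⁻¹ z))`.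
Its real and imaginary parts are finite suprema of real linear combinations of `u` and of elements
`re (ζ⁻¹ z)`, so that no functional calculus is needed. As this inequality is stated by means of
real parts, `T ^ n` can be applied to it, and since `u` is the supremum of all `re (ζ⁻¹ z)`, taking
the infimum over `ζ` at the end gives
`|λ ^ (-k n) T ^ n w - w| ≤ (1 + ε + C) T ^ n u - (1 - ε + C) u`
(`absVal_zpow_smul_pow_sub_le`). Summing with the weights `(s - 1) s ^ (-n - 1)` and using
`(1 - ε) u ≤ |w|` one obtains, with `ε = 1 / 6` and `K = 1 + ε + C`,
`(K + 1 / 2) u ≤ (s - 1) |R(s λ ^ k, T) w| + K (s - 1) R(s, T) u`  for all `s > 1`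
(`exists_smul_absVal_le`).

If `λ ^ k` is not in the spectrum, the first term on the right tends to zero as `s` decreases to
`1`. On the other hand the resolvent identity bounds `R(t, T) R(s, T) u` by
`|s - t|⁻¹ R(min s t, T) u` (`IsPositive.realOp_resolvent_comp_le`), so that of the factors
`(s - 1) R(s, T)` and `(t - 1) R(t, T)` the one with the larger parameter acts almost as a
contraction when the other parameter is close to `1`. Applying `R(t, T)` to the estimate and
passing to norms therefore leads to `K + 1 / 2 ≤ K`, provided that the error term stays negligible.
Either growth condition ensures this: for the first one lets `s → 1` and then takes the supremum over `t`
(`not_isBigO_one_div`), for the second one lets `t → 1` and then `s → 1`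
(`not_norm_resolvent_isBigO`).
-/

/-! ### The resolvent outside the spectral disc -/

section Resolvent

variable {A : Type*} [NormedRing A] [NormedAlgebra ℂ A]

/-- By Gelfand's formula the powers of `μ⁻¹ • a` are summable for `|μ|` beyond the spectral
radius. -/
theorem summable_inv_smul_pow [CompleteSpace A] {a : A} (ha : spectralRadius ℂ a ≤ 1) {μ : ℂ}
    (hμ : 1 < ‖μ‖) :
    Summable fun n : ℕ => (μ⁻¹ • a) ^ n := by
  obtain ⟨q, hq1, hqμ⟩ := exists_between hμ
  have hq0 : 0 < q := one_pos.trans hq1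
  have hlt : spectralRadius ℂ a < ENNReal.ofReal q :=
    ha.trans_lt (by rw [← ENNReal.ofReal_one]; exact (ENNReal.ofReal_lt_ofReal_iff hq0).2 hq1)
  have hev := (spectrum.pow_norm_pow_one_div_tendsto_nhds_spectralRadius a).eventually
    (gt_mem_nhds hlt)
  have hg : Summable fun n : ℕ => (q / ‖μ‖) ^ n :=
    summable_geometric_of_lt_one (by positivity) ((div_lt_one (by positivity)).2 hqμ)
  refine Summable.of_norm_bounded_eventually_nat hg ?_
  filter_upwards [hev, eventually_gt_atTop 0] with n hn hn0
  have h1 : ‖a ^ n‖ ^ (1 / n : ℝ) ≤ q := ((ENNReal.ofReal_lt_ofReal_iff hq0).1 hn).le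
  have h2 : ‖a ^ n‖ ≤ q ^ n := by
    have h3 := pow_le_pow_left₀ (by positivity) h1 n
    rwa [one_div, Real.rpow_inv_natCast_pow (norm_nonneg _) hn0.ne'] at h3
  rw [smul_pow, norm_smul, norm_pow, norm_inv, div_pow, inv_pow, div_eq_inv_mul]
  gcongr

/-- The Neumann series of the resolvent. -/
theorem hasSum_resolvent [CompleteSpace A] {a : A} (ha : spectralRadius ℂ a ≤ 1) {μ : ℂ}
    (hμ : 1 < ‖μ‖) :
    HasSum (fun n : ℕ => μ⁻¹ ^ (n + 1) • a ^ n) (resolvent a μ) := by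
  have hμ0 : μ ≠ 0 := by rintro rfl; norm_num at hμ
  have hs := summable_inv_smul_pow ha hμ
  set S := ∑' n : ℕ, (μ⁻¹ • a) ^ n with hS
  have hfac : algebraMap ℂ A μ - a = μ • (1 - μ⁻¹ • a) := by
    rw [smul_sub, smul_inv_smul₀ hμ0, Algebra.algebraMap_eq_smul_one]
  have h1 : (algebraMap ℂ A μ - a) * (μ⁻¹ • S) = 1 := by
    rw [hfac, smul_mul_smul_comm, mul_inv_cancel₀ hμ0, hs.one_sub_mul_tsum_pow, one_smul]
  have h2 : (μ⁻¹ • S) * (algebraMap ℂ A μ - a) = 1 := by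
    rw [hfac, smul_mul_smul_comm, inv_mul_cancel₀ hμ0, hs.tsum_pow_mul_one_sub, one_smul]
  have h3 : resolvent a μ = μ⁻¹ • S := by
    have hu : IsUnit (algebraMap ℂ A μ - a) := ⟨⟨_, _, h1, h2⟩, rfl⟩
    rw [resolvent, ← mul_one (Ring.inverse _), ← h1, Ring.inverse_mul_cancel_left _ _ hu]
  rw [h3]
  convert! hs.hasSum.const_smul μ⁻¹ using 2 with n
  rw [smul_pow, smul_smul, pow_succ']

/-- The first resolvent identity, in the form solved for the product. -/
theorem smul_resolvent_mul_resolvent {a : A} {s t : ℂ} (hs : s ∈ resolventSet ℂ a)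
    (ht : t ∈ resolventSet ℂ a) :
    (s - t) • (resolvent a t * resolvent a s) = resolvent a t - resolvent a s := by
  have h1 : resolvent a t * (algebraMap ℂ A t - a) = 1 := Ring.inverse_mul_cancel _ ht
  have h2 : (algebraMap ℂ A s - a) * resolvent a s = 1 := Ring.mul_inverse_cancel _ hs
  calc (s - t) • (resolvent a t * resolvent a s)
      = resolvent a t * ((algebraMap ℂ A s - a) - (algebraMap ℂ A t - a)) * resolvent a s := by
        rw [sub_sub_sub_cancel_right, ← map_sub, Algebra.algebraMap_eq_smul_one, mul_smul_comm,
          mul_one, smul_mul_assoc]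
    _ = resolvent a t - resolvent a s := by
        rw [mul_sub, sub_mul, h1, mul_assoc, h2, mul_one, one_mul]

end Resolvent

theorem hasSum_inv_pow_succ {s : ℝ} (hs : 1 < s) :
    HasSum (fun n : ℕ => s⁻¹ ^ (n + 1)) (1 / (s - 1)) := by
  have h := (hasSum_geometric_of_lt_one (inv_nonneg.2 (by linarith)) (inv_lt_one_of_one_lt₀ hs)
    ).mul_left s⁻¹
  convert! h using 1
  · ext n; rw [pow_succ']
  · have : s - 1 ≠ 0 := by linarith
    have : s ≠ 0 := by linarith
    field_simp

theorem norm_le_norm_of_nonneg_of_le {X : Type*} [NormedAddCommGroup X] [Lattice X]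
    [IsOrderedAddMonoid X] [HasSolidNorm X] {x y : X} (hx : 0 ≤ x) (hxy : x ≤ y) : ‖x‖ ≤ ‖y‖ :=
  norm_le_norm_of_abs_le_abs (by rwa [abs_of_nonneg hx, abs_of_nonneg (hx.trans hxy)])

/-! ### The modulus on a complex Banach lattice -/

namespace ComplexBanachLattice

variable {X E : Type*} [NormedAddCommGroup X] [Lattice X]
    [IsOrderedAddMonoid X] [HasSolidNorm X] [NormedSpace ℝ X] [IsOrderedModule ℝ X]
    [CompleteSpace X] [NormedAddCommGroup E] [NormedSpace ℂ E]

/-- The modulus of an element, as an element of the real part `X`. -/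
noncomputable def absVal (L : ComplexBanachLattice X E) (v : E) : X :=
  complexModulus (L.re v) (L.im v)

variable (L : ComplexBanachLattice X E)

theorem modulus_eq (v : E) : L.modulus v = L.ofReal (L.absVal v) := rfl

theorem equiv_re_im (v : E) : L.equiv (L.re v, L.im v) = v := L.equiv.apply_symm_apply v

theorem norm_absVal (v : E) : ‖L.absVal v‖ = ‖v‖ := by
  rw [absVal, ← L.norm_equiv, L.equiv_re_im]

theorem re_add (v w : E) : L.re (v + w) = L.re v + L.re w := by simp [re]

theorem re_sub (v w : E) : L.re (v - w) = L.re v - L.re w := by simp [re]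

theorem ofReal_add (x y : X) : L.ofReal (x + y) = L.ofReal x + L.ofReal y := by
  rw [ofReal, ofReal, ofReal, ← map_add]; simp

theorem ofReal_sub (x y : X) : L.ofReal (x - y) = L.ofReal x - L.ofReal y := by
  rw [ofReal, ofReal, ofReal, ← map_sub]; simp

theorem ofReal_smul (c : ℝ) (x : X) : L.ofReal (c • x) = c • L.ofReal x := by
  rw [ofReal, ofReal, ← map_smul]; simp

theorem re_ofReal (x : X) : L.re (L.ofReal x) = x := by simp [re, ofReal]

theorem im_ofReal (x : X) : L.im (L.ofReal x) = 0 := by simp [im, ofReal]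

theorem I_smul_ofReal (x : X) : Complex.I • L.ofReal x = L.equiv (0, x) := by
  rw [ofReal, L.I_smul_equiv, neg_zero]

theorem eq_ofReal_add (v : E) : v = L.ofReal (L.re v) + Complex.I • L.ofReal (L.im v) := by
  rw [I_smul_ofReal, ofReal, ← map_add]
  simp [L.equiv_re_im]

theorem smul_eq_equiv (c : ℂ) (v : E) : c • v =
    L.equiv (c.re • L.re v - c.im • L.im v, c.re • L.im v + c.im • L.re v) := by
  have h : c • v = c.re • v + c.im • (Complex.I • v) := by
    conv_lhs => rw [← Complex.re_add_im c, add_smul, mul_smul]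
    rfl
  rw [h]
  conv_lhs => rw [← L.equiv_re_im v]
  rw [L.I_smul_equiv, ← map_smul, ← map_smul, ← map_add]
  congr 1
  ext
  · simp [sub_eq_add_neg]
  · simp

theorem re_smul (c : ℂ) (v : E) : L.re (c • v) = c.re • L.re v - c.im • L.im v := by
  conv_lhs => rw [re, smul_eq_equiv L, LinearEquiv.symm_apply_apply]

theorem re_real_smul (c : ℝ) (v : E) : L.re (c • v) = c • L.re v := by simp [re]

theorem re_smul_ofReal (c : ℂ) (x : X) : L.re (c • L.ofReal x) = c.re • x := by
  rw [re_smul, re_ofReal, im_ofReal, smul_zero, sub_zero]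

theorem absVal_le_iff {v : E} {b : X} :
    L.absVal v ≤ b ↔ ∀ c : ℂ, ‖c‖ = 1 → L.re (c • v) ≤ b := by
  have key : L.absVal v ≤ b ↔ ∀ θ : ℝ, Real.cos θ • L.re v + Real.sin θ • L.im v ≤ b := by
    rw [absVal, isLUB_le_iff (isLUB_complexModulus _ _)]
    simp [upperBounds]
  rw [key]
  refine ⟨fun h c hc => ?_, fun h θ => ?_⟩
  · have h1 := h (-Complex.arg c)
    have h2 : Real.cos (Complex.arg c) = c.re := by
      rw [Complex.cos_arg (by rintro rfl; simp at hc), hc, div_one]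
    have h3 : Real.sin (Complex.arg c) = c.im := by rw [Complex.sin_arg, hc, div_one]
    rwa [Real.cos_neg, Real.sin_neg, h2, h3, neg_smul, ← sub_eq_add_neg, ← re_smul] at h1
  · have h1 := h (Complex.exp (((-θ : ℝ) : ℂ) * Complex.I)) (Complex.norm_exp_ofReal_mul_I _)
    rwa [re_smul, Complex.exp_ofReal_mul_I_re, Complex.exp_ofReal_mul_I_im, Real.cos_neg,
      Real.sin_neg, neg_smul, sub_neg_eq_add] at h1

theorem re_smul_le_absVal {c : ℂ} (hc : ‖c‖ = 1) (v : E) : L.re (c • v) ≤ L.absVal v :=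
  L.absVal_le_iff.1 le_rfl c hc

theorem absVal_nonneg (v : E) : 0 ≤ L.absVal v := by
  have h1 := L.re_smul_le_absVal (c := 1) (by simp) v
  have h2 := L.re_smul_le_absVal (c := -1) (by simp) v
  have h3 := add_le_add h1 h2
  rw [← re_add, ← add_smul, add_neg_cancel, zero_smul, ← two_smul ℝ (L.absVal v)] at h3
  have h4 : (0 : X) ≤ (2 : ℝ) • L.absVal v := by simpa [re] using h3
  have h5 := smul_le_smul_of_nonneg_left h4 (show (0 : ℝ) ≤ 1 / 2 by norm_num)
  rwa [smul_zero, smul_smul, show (1 / 2 : ℝ) * 2 = 1 by norm_num, one_smul] at h5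

theorem re_smul_le (c : ℂ) (v : E) : L.re (c • v) ≤ ‖c‖ • L.absVal v := by
  rcases eq_or_ne c 0 with rfl | hc
  · simp [re]
  · have hc' : ‖c‖ ≠ 0 := norm_ne_zero_iff.2 hc
    have h1 := L.re_smul_le_absVal (c := (‖c‖⁻¹ : ℝ) • c) (by simp [hc']) v
    rw [smul_assoc, re_real_smul] at h1
    have h2 := smul_le_smul_of_nonneg_left h1 (norm_nonneg c)
    rwa [smul_smul, mul_inv_cancel₀ hc', one_smul] at h2

theorem absVal_add_le (v w : E) : L.absVal (v + w) ≤ L.absVal v + L.absVal w := by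
  refine L.absVal_le_iff.2 fun c hc => ?_
  rw [smul_add, re_add]
  exact add_le_add (L.re_smul_le_absVal hc v) (L.re_smul_le_absVal hc w)

theorem absVal_smul_le (c : ℂ) (v : E) : L.absVal (c • v) ≤ ‖c‖ • L.absVal v := by
  refine L.absVal_le_iff.2 fun d hd => ?_
  rw [smul_smul]
  simpa [hd] using L.re_smul_le (d * c) v

theorem absVal_smul_of_norm_eq_one {c : ℂ} (hc : ‖c‖ = 1) (v : E) :
    L.absVal (c • v) = L.absVal v := by
  refine le_antisymm (by simpa [hc] using L.absVal_smul_le c v) ?_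
  have hc0 : c ≠ 0 := by rintro rfl; simp at hc
  have h := L.absVal_smul_le c⁻¹ (c • v)
  rwa [inv_smul_smul₀ hc0, norm_inv, hc, inv_one, one_smul] at h

theorem absVal_sub_comm (v w : E) : L.absVal (v - w) = L.absVal (w - v) := by
  rw [← L.absVal_smul_of_norm_eq_one (c := -1) (by simp) (v - w), neg_one_smul, neg_sub]

theorem absVal_smul_ofReal_le (c : ℂ) (x : X) : L.absVal (c • L.ofReal x) ≤ ‖c‖ • |x| := by
  refine L.absVal_le_iff.2 fun d hd => ?_
  rw [smul_smul, re_smul_ofReal]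
  exact smul_le_smul_abs_of_abs_le
    ((Complex.abs_re_le_norm _).trans (by rw [norm_mul, hd, one_mul])) x

theorem absVal_ofReal (x : X) : L.absVal (L.ofReal x) = |x| := by
  refine le_antisymm (by simpa using L.absVal_smul_ofReal_le 1 x) (abs_le'.2 ⟨?_, ?_⟩)
  · simpa [re_ofReal] using L.re_smul_le_absVal (c := 1) (by simp) (L.ofReal x)
  · have h := L.re_smul_le_absVal (c := -1) (by simp) (L.ofReal x)
    rwa [re_smul_ofReal, Complex.neg_re, Complex.one_re, neg_one_smul] at h

theorem norm_ofReal (x : X) : ‖L.ofReal x‖ = ‖x‖ := by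
  rw [← L.norm_absVal, L.absVal_ofReal, norm_abs_eq_norm]

theorem norm_re_le (v : E) : ‖L.re v‖ ≤ ‖v‖ := by
  rw [← L.norm_absVal v]
  refine norm_le_norm_of_abs_le_abs ?_
  rw [abs_of_nonneg (L.absVal_nonneg v)]
  refine abs_le'.2 ⟨?_, ?_⟩
  · simpa using L.re_smul_le_absVal (c := 1) (by simp) v
  · simpa [re] using L.re_smul_le_absVal (c := -1) (by simp) v

/-- The real part as a continuous `ℝ`-linear map. -/
noncomputable def reL : E →L[ℝ] X :=
  LinearMap.mkContinuous
    { toFun := L.re, map_add' := L.re_add, map_smul' := L.re_real_smul } 1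
    fun v => by simpa using L.norm_re_le v

/-- The inclusion of the real part as a continuous `ℝ`-linear map. -/
noncomputable def ofRealL : X →L[ℝ] E :=
  LinearMap.mkContinuous
    { toFun := L.ofReal, map_add' := L.ofReal_add, map_smul' := L.ofReal_smul } 1
    fun x => by simpa using (L.norm_ofReal x).le

/-- The compression of an operator to the real part. For a positive operator this is its
restriction to the real part. -/
noncomputable def realOp (S : E →L[ℂ] E) : X →L[ℝ] X :=
  L.reL ∘L S.restrictScalars ℝ ∘L L.ofRealL

theorem realOp_apply (S : E →L[ℂ] E) (x : X) : L.realOp S x = L.re (S (L.ofReal x)) := rfl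

end ComplexBanachLattice

/-! ### Positive operators -/

namespace ComplexBanachLattice

variable {X E : Type*} [NormedAddCommGroup X] [Lattice X]
    [IsOrderedAddMonoid X] [HasSolidNorm X] [NormedSpace ℝ X] [IsOrderedModule ℝ X]
    [CompleteSpace X] [NormedAddCommGroup E] [NormedSpace ℂ E]
    {L : ComplexBanachLattice X E}

theorem IsPositive.exists_apply_eq {S : E →L[ℂ] E} (hS : L.IsPositive S) {x : X} (hx : 0 ≤ x) :
    ∃ y : X, 0 ≤ y ∧ S (L.ofReal x) = L.ofReal y := by
  obtain ⟨y, hy, h⟩ := hS ⟨x, hx, rfl⟩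
  exact ⟨y, hy, h.symm⟩

theorem IsPositive.realOp_nonneg {S : E →L[ℂ] E} (hS : L.IsPositive S) {x : X} (hx : 0 ≤ x) :
    0 ≤ L.realOp S x := by
  obtain ⟨y, hy, h⟩ := hS.exists_apply_eq hx
  rwa [realOp_apply, h, re_ofReal]

theorem IsPositive.realOp_mono {S : E →L[ℂ] E} (hS : L.IsPositive S) {x y : X} (hxy : x ≤ y) :
    L.realOp S x ≤ L.realOp S y := by
  have h := hS.realOp_nonneg (sub_nonneg.2 hxy)
  rwa [map_sub, sub_nonneg] at h

/-- A positive operator is real: it maps the real part into itself. -/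
theorem IsPositive.apply_ofReal {S : E →L[ℂ] E} (hS : L.IsPositive S) (x : X) :
    S (L.ofReal x) = L.ofReal (L.realOp S x) := by
  obtain ⟨y, -, hy⟩ := hS.exists_apply_eq (posPart_nonneg x)
  obtain ⟨y', -, hy'⟩ := hS.exists_apply_eq (negPart_nonneg x)
  have h : S (L.ofReal x) = L.ofReal (y - y') := by
    rw [← posPart_sub_negPart x, ofReal_sub, map_sub, hy, hy', ofReal_sub]
  rw [realOp_apply, h, re_ofReal]

theorem IsPositive.re_apply {S : E →L[ℂ] E} (hS : L.IsPositive S) (v : E) :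
    L.re (S v) = L.realOp S (L.re v) := by
  conv_lhs => rw [L.eq_ofReal_add v]
  rw [map_add, map_smul, hS.apply_ofReal, hS.apply_ofReal, re_add, re_ofReal, re_smul_ofReal,
    Complex.I_re, zero_smul, add_zero]

theorem IsPositive.absVal_apply_le {S : E →L[ℂ] E} (hS : L.IsPositive S) (v : E) :
    L.absVal (S v) ≤ L.realOp S (L.absVal v) := by
  refine L.absVal_le_iff.2 fun c hc => ?_
  rw [← map_smul, hS.re_apply]
  exact hS.realOp_mono (L.re_smul_le_absVal hc v)

theorem IsPositive.pow {S : E →L[ℂ] E} (hS : L.IsPositive S) (n : ℕ) : L.IsPositive (S ^ n) := by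
  induction n with
  | zero => exact fun v hv => hv
  | succ n ih =>
    intro v hv
    rw [pow_succ]
    exact ih (hS hv)

theorem IsPositive.norm_apply_ofReal {S : E →L[ℂ] E} (hS : L.IsPositive S) (x : X) :
    ‖S (L.ofReal x)‖ = ‖L.realOp S x‖ := by
  rw [hS.apply_ofReal, norm_ofReal]

theorem IsPositive.realOp_mul_apply {S S' : E →L[ℂ] E} (hS' : L.IsPositive S') (x : X) :
    L.realOp (S * S') x = L.realOp S (L.realOp S' x) := by
  rw [realOp_apply, realOp_apply L S, ← hS'.apply_ofReal]
  rfl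

theorem hasSum_re {f : ℕ → E} {v : E} (h : HasSum f v) : HasSum (fun n => L.re (f n)) (L.re v) :=
  h.mapL L.reL

theorem IsPositive.absVal_le_realOp_pow (hT : L.IsPositive T) {lam : ℂ} (hlam : ‖lam‖ = 1) {z : E}
    (hz : T z = lam • z) (n : ℕ) : (T ^ n) z = lam ^ n • z ∧
    L.absVal z ≤ L.realOp (T ^ n) (L.absVal z) := by
  have h : (T ^ n) z = lam ^ n • z := by
    induction n with
    | zero => simp
    | succ n ih => rw [pow_succ, mul_apply_eq_comp, hz, map_smul, ih, smul_smul,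
        pow_succ']
  refine ⟨h, ?_⟩
  have h1 := (hT.pow n).absVal_apply_le z
  rwa [h, L.absVal_smul_of_norm_eq_one (by rw [norm_pow, hlam, one_pow])] at h1

variable [CompleteSpace E] {T : E →L[ℂ] E} {s : ℝ}

theorem hasSum_resolvent_apply (hrad : spectralRadius ℂ T ≤ 1) {μ : ℂ} (hμ : 1 < ‖μ‖) (v : E) :
    HasSum (fun n : ℕ => μ⁻¹ ^ (n + 1) • (T ^ n) v) (resolvent T μ v) :=
  (hasSum_resolvent hrad hμ).mapL (ContinuousLinearMap.apply ℂ E v)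

theorem one_lt_norm_ofReal (hs : 1 < s) : 1 < ‖(s : ℂ)‖ := by
  rwa [Complex.norm_real, Real.norm_of_nonneg (by linarith)]

theorem hasSum_realOp_resolvent (hrad : spectralRadius ℂ T ≤ 1) (hs : 1 < s) (x : X) :
    HasSum (fun n : ℕ => s⁻¹ ^ (n + 1) • L.realOp (T ^ n) x)
      (L.realOp (resolvent T (s : ℂ)) x) := by
  convert! hasSum_re (L := L) (hasSum_resolvent_apply hrad (one_lt_norm_ofReal hs) (L.ofReal x))
    using 2 with n
  rw [realOp_apply, ← re_real_smul, ← Complex.coe_smul]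
  push_cast
  rfl

theorem IsPositive.resolvent_ofReal (hT : L.IsPositive T) (hrad : spectralRadius ℂ T ≤ 1)
    (hs : 1 < s) : L.IsPositive (resolvent T (s : ℂ)) := by
  rintro _ ⟨x, hx, rfl⟩
  have h1 := hasSum_realOp_resolvent (L := L) hrad hs x
  have h2 := hasSum_resolvent_apply hrad (one_lt_norm_ofReal hs) (L.ofReal x)
  refine ⟨L.realOp (resolvent T (s : ℂ)) x, h1.nonneg fun n => ?_,
    (h1.mapL L.ofRealL).unique ?_⟩
  · exact smul_nonneg (by positivity) ((hT.pow n).realOp_nonneg hx)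
  · convert! h2 using 2 with n
    rw [(hT.pow n).apply_ofReal, map_smul, ← Complex.coe_smul]
    push_cast
    rfl

end ComplexBanachLattice

/-! ### Approximate powers of an element -/

/-- Quantitative strict convexity of the unit disc. It makes the defects of `z` relative to two
directions `η` and `ζ` add up to at least `‖η - ζ‖ ^ 2 / 4` times `|z|`. -/
theorem norm_add_le_two_sub {η ζ : ℂ} (hη : ‖η‖ = 1) (hζ : ‖ζ‖ = 1) :
    ‖η + ζ‖ ≤ 2 - ‖η - ζ‖ ^ 2 / 4 := by
  have h := parallelogram_law_with_norm ℝ η ζ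
  rw [hη, hζ] at h
  have h1 : ‖η + ζ‖ ≤ 2 := by linarith [norm_add_le η ζ]
  nlinarith [norm_nonneg (η + ζ)]

theorem norm_inv_sub_inv_of_norm_eq_one {η ζ : ℂ} (hη : ‖η‖ = 1) (hζ : ‖ζ‖ = 1) :
    ‖η⁻¹ - ζ⁻¹‖ = ‖η - ζ‖ := by
  have h1 : η ≠ 0 := by rintro rfl; simp at hη
  have h2 : ζ ≠ 0 := by rintro rfl; simp at hζ
  rw [inv_sub_inv h1 h2, norm_div, norm_mul, hη, hζ, norm_sub_rev]
  simp

/-- Integer powers are Lipschitz on the unit circle. -/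
theorem exists_norm_zpow_sub_zpow_le (k : ℤ) : ∃ c : ℝ, 0 ≤ c ∧
    ∀ η ζ : ℂ, ‖η‖ = 1 → ‖ζ‖ = 1 → ‖η ^ k - ζ ^ k‖ ≤ c * ‖η - ζ‖ := by
  have step : ∀ a b η ζ : ℂ, ‖b‖ = 1 → ‖η‖ = 1 → ‖a * η - b * ζ‖ ≤ ‖a - b‖ + ‖η - ζ‖ := by
    intro a b η ζ hb hη
    calc ‖a * η - b * ζ‖ = ‖(a - b) * η + b * (η - ζ)‖ := by ring_nf
      _ ≤ ‖a - b‖ + ‖η - ζ‖ := by simpa [hb, hη] using norm_add_le ((a - b) * η) (b * (η - ζ))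
  have hne : ∀ ζ : ℂ, ‖ζ‖ = 1 → ζ ≠ 0 := by rintro ζ h rfl; simp at h
  induction k with
  | zero => exact ⟨0, le_rfl, by simp⟩
  | succ i ih =>
    obtain ⟨c, hc, h⟩ := ih
    refine ⟨c + 1, by linarith, fun η ζ hη hζ => ?_⟩
    rw [zpow_add_one₀ (hne η hη), zpow_add_one₀ (hne ζ hζ)]
    linarith [h η ζ hη hζ, step (η ^ (i : ℤ)) (ζ ^ (i : ℤ)) η ζ (by simp [hζ]) hη]
  | pred i ih =>
    obtain ⟨c, hc, h⟩ := ih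
    refine ⟨c + 1, by linarith, fun η ζ hη hζ => ?_⟩
    rw [zpow_sub_one₀ (hne η hη), zpow_sub_one₀ (hne ζ hζ)]
    have h1 := norm_inv_sub_inv_of_norm_eq_one hη hζ
    linarith [h η ζ hη hζ,
      step (η ^ (-i : ℤ)) (ζ ^ (-i : ℤ)) η⁻¹ ζ⁻¹ (by simp [hζ]) (by simp [hη])]

namespace ComplexBanachLattice

variable {X E : Type*} [NormedAddCommGroup X] [Lattice X]
    [IsOrderedAddMonoid X] [HasSolidNorm X] [NormedSpace ℝ X] [IsOrderedModule ℝ X]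
    [CompleteSpace X] [NormedAddCommGroup E] [NormedSpace ℂ E]
    (L : ComplexBanachLattice X E)

/-- For a Lipschitz function `f` on the circle there is an `a : X` playing the role of
`|z| f(z / |z|)` up to a relative error `ε`. The defect `|z| - re (ζ⁻¹ z)` measures how far `z`
is from having direction `ζ`. -/
theorem exists_abs_sub_smul_le {f : ℂ → ℝ} {c : ℝ} (hc : 0 ≤ c)
    (hf : ∀ η ζ : ℂ, ‖η‖ = 1 → ‖ζ‖ = 1 → |f η - f ζ| ≤ c * ‖η - ζ‖) {ε : ℝ} (hε : 0 < ε) (z : E) :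
    ∃ a : X, ∀ ζ : ℂ, ‖ζ‖ = 1 → |a - f ζ • L.absVal z| ≤
      ε • L.absVal z + (c ^ 2 / ε) • (L.absVal z - L.re (ζ⁻¹ • z)) := by
  set u := L.absVal z with hu
  have hu0 : 0 ≤ u := L.absVal_nonneg z
  set C := c ^ 2 / ε with hC
  have hC0 : 0 ≤ C := by positivity
  set δ : ℝ := ε / (c + C + 1) with hδ
  have hδ0 : 0 < δ := by positivity
  obtain ⟨t, hts, htf, htc⟩ := Metric.finite_approx_of_totallyBounded
    (isCompact_sphere (0 : ℂ) 1).totallyBounded δ hδ0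
  have ht1 : ∀ η ∈ htf.toFinset, ‖η‖ = 1 := fun η hη => by
    simpa using hts (htf.mem_toFinset.1 hη)
  have net : ∀ ζ : ℂ, ‖ζ‖ = 1 → ∃ η ∈ htf.toFinset, ‖η - ζ‖ < δ := by
    intro ζ hζ
    obtain ⟨η, hη, h⟩ := Set.mem_iUnion₂.1
      (htc (show ζ ∈ Metric.sphere (0 : ℂ) 1 by simpa using hζ))
    exact ⟨η, htf.mem_toFinset.2 hη, by rwa [Metric.mem_ball, dist_comm, dist_eq_norm] at h⟩
  have hne : htf.toFinset.Nonempty := by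
    obtain ⟨η, hη, -⟩ := net 1 (by simp)
    exact ⟨η, hη⟩
  set g : ℂ → X := fun η => f η • u - C • (u - L.re (η⁻¹ • z)) with hg
  -- A McShane-type extension: the largest of the minorants prescribed by a finite net of
  -- directions. The first bullet shows that these minorants are compatible with one another.
  refine ⟨htf.toFinset.sup' hne g, fun ζ hζ => abs_le'.2 ⟨?_, ?_⟩⟩
  · rw [sub_le_iff_le_add]
    refine Finset.sup'_le _ _ fun η hη => ?_
    have hη1 := ht1 η hη
    set d := ‖η - ζ‖ with hd
    have h1 : L.re (η⁻¹ • z) + L.re (ζ⁻¹ • z) ≤ (2 - d ^ 2 / 4) • u := by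
      rw [← re_add, ← add_smul]
      refine (L.re_smul_le _ z).trans (smul_le_smul_of_nonneg_right ?_ hu0)
      rw [hd, ← norm_inv_sub_inv_of_norm_eq_one hη1 hζ]
      exact norm_add_le_two_sub (by simp [hη1]) (by simp [hζ])
    -- Completing the square; this is where `C = c ^ 2 / ε` comes from.
    have h2 : f η - f ζ ≤ ε + C * (d ^ 2 / 4) := by
      refine (le_abs_self _).trans ((hf η ζ hη1 hζ).trans ?_)
      have h3 : ε + C * (d ^ 2 / 4) - c * d = (ε - c * d / 2) ^ 2 / ε := by
        rw [hC]; field_simp; ring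
      have h4 : 0 ≤ (ε - c * d / 2) ^ 2 / ε := by positivity
      linarith
    have h5 := add_nonneg (smul_nonneg hC0 (sub_nonneg.2 h1))
      (smul_nonneg (sub_nonneg.2 h2) hu0)
    rw [← sub_nonneg]
    convert! h5 using 1
    simp only [hg]
    module
  · obtain ⟨η, hη, hηd⟩ := net ζ hζ
    have hη1 := ht1 η hη
    have h1 : L.re (ζ⁻¹ • z) - L.re (η⁻¹ • z) ≤ δ • u := by
      rw [← re_sub, ← sub_smul]
      refine (L.re_smul_le _ z).trans (smul_le_smul_of_nonneg_right ?_ hu0)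
      rw [norm_inv_sub_inv_of_norm_eq_one hζ hη1, norm_sub_rev]
      exact hηd.le
    have h2 : f ζ - f η ≤ c * δ := by
      refine (le_abs_self _).trans ((hf ζ η hζ hη1).trans ?_)
      rw [norm_sub_rev]
      gcongr
    have h3 : c * δ + C * δ ≤ ε := by
      have : (c + C + 1) * δ = ε := by rw [hδ]; field_simp
      nlinarith
    have h5 := add_nonneg (smul_nonneg hC0 (sub_nonneg.2 h1))
      (smul_nonneg (show 0 ≤ ε - C * δ - (f ζ - f η) by linarith) hu0)
    rw [neg_sub, sub_le_comm]
    refine le_trans ?_ (Finset.le_sup' g hη)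
    rw [← sub_nonneg]
    convert! h5 using 1
    simp only [hg]
    module

/-- An element `w` playing the role of `|z| sgn(z) ^ k` up to a relative error `ε`: it is close to
`ζ ^ k |z|` wherever `z` is close to `ζ |z|`. -/
theorem exists_absVal_sub_zpow_smul_le (k : ℤ) {ε : ℝ} (hε : 0 < ε) (z : E) :
    ∃ C : ℝ, 0 ≤ C ∧ ∃ w : E, ∀ ζ : ℂ, ‖ζ‖ = 1 → L.absVal (w - ζ ^ k • L.ofReal (L.absVal z)) ≤
      ε • L.absVal z + C • (L.absVal z - L.re (ζ⁻¹ • z)) := by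
  obtain ⟨c, hc, hck⟩ := exists_norm_zpow_sub_zpow_le k
  obtain ⟨a, ha⟩ := L.exists_abs_sub_smul_le (f := fun ζ => (ζ ^ k).re) hc
    (fun η ζ hη hζ => by
      rw [← Complex.sub_re]
      exact (Complex.abs_re_le_norm _).trans (hck η ζ hη hζ)) (half_pos hε) z
  obtain ⟨b, hb⟩ := L.exists_abs_sub_smul_le (f := fun ζ => (ζ ^ k).im) hc
    (fun η ζ hη hζ => by
      rw [← Complex.sub_im]
      exact (Complex.abs_im_le_norm _).trans (hck η ζ hη hζ)) (half_pos hε) z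
  refine ⟨c ^ 2 / (ε / 2) + c ^ 2 / (ε / 2), by positivity,
    L.ofReal a + Complex.I • L.ofReal b, fun ζ hζ => ?_⟩
  set u := L.absVal z
  have h1 : L.ofReal a + Complex.I • L.ofReal b - ζ ^ k • L.ofReal u =
      (1 : ℂ) • L.ofReal (a - (ζ ^ k).re • u) + Complex.I • L.ofReal (b - (ζ ^ k).im • u) := by
    conv_lhs => rw [← Complex.re_add_im (ζ ^ k)]
    rw [ofReal_sub, ofReal_sub, ofReal_smul, ofReal_smul, ← Complex.coe_smul, ← Complex.coe_smul]
    module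
  rw [h1]
  refine (L.absVal_add_le _ _).trans ((add_le_add (L.absVal_smul_ofReal_le _ _)
    (L.absVal_smul_ofReal_le _ _)).trans ?_)
  rw [norm_one, Complex.norm_I, one_smul, one_smul]
  refine (add_le_add (ha ζ hζ) (hb ζ hζ)).trans (le_of_eq ?_)
  module

end ComplexBanachLattice

/-! ### The lower bound for the resolvent along the peripheral eigenvector -/

namespace ComplexBanachLattice

variable {X E : Type*} [NormedAddCommGroup X] [Lattice X]
    [IsOrderedAddMonoid X] [HasSolidNorm X] [NormedSpace ℝ X] [IsOrderedModule ℝ X]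
    [CompleteSpace X] [NormedAddCommGroup E] [NormedSpace ℂ E]
    {L : ComplexBanachLattice X E} {T : E →L[ℂ] E} {lam : ℂ} {z : E}

theorem smul_absVal_le_of_forall {C : ℝ} (hC : 0 ≤ C) {y : X}
    (h : ∀ ζ : ℂ, ‖ζ‖ = 1 → C • L.re (ζ⁻¹ • z) ≤ y) : C • L.absVal z ≤ y := by
  rcases hC.eq_or_lt with rfl | hC
  · simpa using h 1 (by simp)
  · have h1 : L.absVal z ≤ C⁻¹ • y := L.absVal_le_iff.2 fun c hc => by
      have h2 := smul_le_smul_of_nonneg_left (h c⁻¹ (by simp [hc])) (inv_nonneg.2 hC.le)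
      rwa [inv_inv, inv_smul_smul₀ hC.ne'] at h2
    have h2 := smul_le_smul_of_nonneg_left h1 hC.le
    rwa [smul_inv_smul₀ hC.ne'] at h2

theorem one_sub_smul_absVal_le {k : ℤ} {ε C : ℝ} (hC : 0 ≤ C) {w : E}
    (hw : ∀ ζ : ℂ, ‖ζ‖ = 1 → L.absVal (w - ζ ^ k • L.ofReal (L.absVal z)) ≤
      ε • L.absVal z + C • (L.absVal z - L.re (ζ⁻¹ • z))) :
    (1 - ε) • L.absVal z ≤ L.absVal w := by
  set u := L.absVal z with hu
  have h1 : C • u ≤ L.absVal w + (ε + C - 1) • u := by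
    refine smul_absVal_le_of_forall hC fun ζ hζ => ?_
    have h2 : u ≤ L.absVal w + (ε • u + C • (u - L.re (ζ⁻¹ • z))) := by
      calc u = L.absVal (ζ ^ k • L.ofReal u) := by
            rw [L.absVal_smul_of_norm_eq_one (by simp [hζ]), absVal_ofReal,
              abs_of_nonneg (L.absVal_nonneg z)]
        _ = L.absVal (w + (ζ ^ k • L.ofReal u - w)) := by rw [add_sub_cancel]
        _ ≤ L.absVal w + L.absVal (ζ ^ k • L.ofReal u - w) := L.absVal_add_le _ _
        _ ≤ _ := by
            rw [L.absVal_sub_comm (ζ ^ k • L.ofReal u)]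
            exact add_le_add_right (hw ζ hζ) _
    rw [← sub_nonneg] at h2 ⊢
    convert! h2 using 1
    module
  rw [← sub_nonneg] at h1 ⊢
  convert! h1 using 1
  module

/-- Where `T ^ n |z|` is close to `|z|`, the approximate `k`-th power `w` of the eigenvector `z`
is an approximate eigenvector of `T ^ n` for the eigenvalue `(λ ^ k) ^ n`. -/
theorem absVal_zpow_smul_pow_sub_le (hT : L.IsPositive T) (hlam : ‖lam‖ = 1)
    (hz : T z = lam • z) {k : ℤ} {ε C : ℝ} (hC : 0 ≤ C) {w : E}
    (hw : ∀ ζ : ℂ, ‖ζ‖ = 1 → L.absVal (w - ζ ^ k • L.ofReal (L.absVal z)) ≤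
      ε • L.absVal z + C • (L.absVal z - L.re (ζ⁻¹ • z))) (n : ℕ) :
    L.absVal (((lam ^ k) ^ n)⁻¹ • (T ^ n) w - w) ≤
      (1 + ε + C) • L.realOp (T ^ n) (L.absVal z) - (1 - ε + C) • L.absVal z := by
  obtain ⟨hzn, hun⟩ := hT.absVal_le_realOp_pow hlam hz n
  have hP := hT.pow n
  set u := L.absVal z with hu
  set P := T ^ n with hPdef
  set y := L.absVal (((lam ^ k) ^ n)⁻¹ • P w - w) with hy
  have hlam0 : lam ≠ 0 := by rintro rfl; simp at hlam
  set m := lam ^ n with hm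
  have hm1 : ‖m‖ = 1 := by rw [hm, norm_pow, hlam, one_pow]
  have hm0 : m ≠ 0 := pow_ne_zero _ hlam0
  have hmk : (lam ^ k) ^ n = m ^ k := by
    rw [hm, ← zpow_natCast, ← zpow_mul, mul_comm, zpow_mul, zpow_natCast]
  -- The direction `ζ` is free; the infimum over all directions is taken at the end.
  have h1 : (2 * C) • u ≤ (1 + ε + C) • L.realOp P u + (ε + C - 1) • u - y := by
    refine smul_absVal_le_of_forall (by positivity) fun ζ hζ => ?_
    have hA : L.absVal (P w - (m * ζ) ^ k • L.ofReal (L.realOp P u)) ≤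
        ε • L.realOp P u + C • (L.realOp P u - L.re (ζ⁻¹ • z)) := by
      have h2 := hw (m * ζ) (by rw [norm_mul, hm1, hζ, one_mul])
      have h3 := (hP.absVal_apply_le _).trans (hP.realOp_mono h2)
      have h4 : L.realOp P (L.re ((m * ζ)⁻¹ • z)) = L.re (ζ⁻¹ • z) := by
        rw [← hP.re_apply, map_smul, hzn, smul_smul, mul_inv_rev, inv_mul_cancel_right₀ hm0]
      rwa [map_sub, map_smul, hP.apply_ofReal, map_add, map_smul, map_smul, map_sub, h4] at h3
    have hB : L.absVal (ζ ^ k • L.ofReal (L.realOp P u) - ζ ^ k • L.ofReal u) ≤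
        L.realOp P u - u := by
      rw [← smul_sub, ← ofReal_sub, L.absVal_smul_of_norm_eq_one (by simp [hζ]), absVal_ofReal,
        abs_of_nonneg (sub_nonneg.2 hun)]
    have hD := hw ζ hζ
    have hA' : L.absVal ((m ^ k)⁻¹ • P w - ζ ^ k • L.ofReal (L.realOp P u)) ≤
        ε • L.realOp P u + C • (L.realOp P u - L.re (ζ⁻¹ • z)) := by
      rw [← L.absVal_smul_of_norm_eq_one (c := (m ^ k)⁻¹) (by simp [hm1]), smul_sub, smul_smul,
        mul_zpow, inv_mul_cancel_left₀ (zpow_ne_zero _ hm0)] at hA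
      exact hA
    have hsum : y ≤ (ε • L.realOp P u + C • (L.realOp P u - L.re (ζ⁻¹ • z))) +
        ((L.realOp P u - u) + (ε • u + C • (u - L.re (ζ⁻¹ • z)))) := by
      rw [hy, hmk, ← sub_add_sub_cancel _ (ζ ^ k • L.ofReal (L.realOp P u)) w,
        ← sub_add_sub_cancel (ζ ^ k • L.ofReal (L.realOp P u)) (ζ ^ k • L.ofReal u) w]
      refine (L.absVal_add_le _ _).trans (add_le_add hA' ((L.absVal_add_le _ _).trans
        (add_le_add hB ?_)))
      rwa [L.absVal_sub_comm]
    rw [← sub_nonneg] at hsum ⊢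
    convert! hsum using 1
    module
  rw [← sub_nonneg] at h1 ⊢
  convert! h1 using 1
  module

variable [CompleteSpace E]

/-- The decisive estimate: if `(s - 1) R(s λ ^ k, T)` tends to zero as `s` decreases to `1`, then
`(s - 1) R(s, T)` has to enlarge `|z|` by a factor bounded away from `1`. -/
theorem exists_smul_absVal_le (hT : L.IsPositive T) (hrad : spectralRadius ℂ T ≤ 1)
    (hlam : ‖lam‖ = 1) (hz : T z = lam • z) (k : ℤ) :
    ∃ K : ℝ, 0 ≤ K ∧ ∃ w : E, ∀ s : ℝ, 1 < s → (K + 1 / 2) • L.absVal z ≤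
      (s - 1) • L.absVal (resolvent T ((s : ℂ) * lam ^ k) w) +
        (K * (s - 1)) • L.realOp (resolvent T (s : ℂ)) (L.absVal z) := by
  -- With `ε = 1 / 6` the gain `1 - 3 ε` is `1 / 2`.
  obtain ⟨C, hC, w, hw⟩ := L.exists_absVal_sub_zpow_smul_le k (show (0 : ℝ) < 1 / 6 by norm_num) z
  refine ⟨1 + 1 / 6 + C, by linarith, w, fun s hs => ?_⟩
  set u := L.absVal z with hu
  set μ := lam ^ k with hμ
  have hμ1 : ‖μ‖ = 1 := by rw [hμ, norm_zpow, hlam, one_zpow]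
  have hμ0 : μ ≠ 0 := by intro h; simp [h] at hμ1
  have hs0 : 0 < s - 1 := by linarith
  have hR : HasSum (fun n : ℕ => s⁻¹ ^ (n + 1) • ((μ ^ n)⁻¹ • (T ^ n) w))
      (μ • resolvent T ((s : ℂ) * μ) w) := by
    convert! (hasSum_resolvent_apply hrad (μ := (s : ℂ) * μ)
      (by rw [norm_mul, hμ1, mul_one]; exact one_lt_norm_ofReal hs) w).const_smul μ using 2 with n
    rw [← Complex.coe_smul, smul_smul, smul_smul]
    congr 1
    have : (s : ℂ) ≠ 0 := by exact_mod_cast (by linarith : s ≠ 0)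
    push_cast
    rw [mul_inv, mul_pow, pow_succ μ⁻¹, inv_pow μ]
    field_simp
  have hw' := (hasSum_inv_pow_succ hs).smul_const w
  have hu' := (hasSum_inv_pow_succ hs).smul_const u
  have hRu := hasSum_realOp_resolvent (L := L) hrad hs u
  have h1 : L.absVal (μ • resolvent T ((s : ℂ) * μ) w - (1 / (s - 1)) • w) ≤
      (1 + 1 / 6 + C) • L.realOp (resolvent T (s : ℂ)) u -
        (1 - 1 / 6 + C) • (1 / (s - 1)) • u := by
    refine L.absVal_le_iff.2 fun c hc => ?_
    refine hasSum_le (fun n => ?_) (hasSum_re (L := L) ((hR.sub hw').const_smul c))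
      ((hRu.const_smul (1 + 1 / 6 + C)).sub (hu'.const_smul (1 - 1 / 6 + C)))
    have h2 := smul_le_smul_of_nonneg_left ((L.re_smul_le_absVal hc _).trans
      (absVal_zpow_smul_pow_sub_le hT hlam hz hC hw n))
      (show 0 ≤ s⁻¹ ^ (n + 1) by positivity)
    rw [← re_real_smul, smul_comm, smul_sub (s⁻¹ ^ (n + 1)), smul_sub (s⁻¹ ^ (n + 1))] at h2
    rwa [smul_comm (1 + 1 / 6 + C), smul_comm (1 - 1 / 6 + C)]
  have h3 : (1 / (s - 1)) • L.absVal w ≤ L.absVal (resolvent T ((s : ℂ) * μ) w) +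
      ((1 + 1 / 6 + C) • L.realOp (resolvent T (s : ℂ)) u -
        (1 - 1 / 6 + C) • (1 / (s - 1)) • u) := by
    have h4 : L.absVal w ≤ (s - 1) • L.absVal ((1 / (s - 1)) • w) := by
      have h5 := L.absVal_smul_le ((s - 1 : ℝ) : ℂ) ((1 / (s - 1)) • w)
      rwa [Complex.coe_smul, smul_smul, mul_one_div_cancel hs0.ne', one_smul, Complex.norm_real,
        Real.norm_of_nonneg hs0.le] at h5
    have h5 : (1 / (s - 1)) • L.absVal w ≤ L.absVal ((1 / (s - 1)) • w) := by
      have h6 := smul_le_smul_of_nonneg_left h4 (one_div_pos.2 hs0).le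
      rwa [smul_smul (1 / (s - 1)) (s - 1), one_div_mul_cancel hs0.ne', one_smul] at h6
    refine h5.trans ?_
    rw [← sub_sub_cancel (μ • resolvent T ((s : ℂ) * μ) w) ((1 / (s - 1)) • w), sub_eq_add_neg,
      neg_sub]
    refine (L.absVal_add_le _ _).trans (add_le_add ?_ ?_)
    · rw [L.absVal_smul_of_norm_eq_one hμ1]
    · rwa [L.absVal_sub_comm]
  have h7 := smul_le_smul_of_nonneg_left (one_sub_smul_absVal_le hC hw) (one_div_pos.2 hs0).le
  have h8 := smul_le_smul_of_nonneg_left (h7.trans h3) hs0.le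
  rw [← sub_nonneg] at h8 ⊢
  convert! h8 using 1
  rw [← hu]
  have hs0' := hs0.ne'
  match_scalars <;> field_simp
  ring

theorem IsPositive.one_div_smul_absVal_le (hT : L.IsPositive T) (hrad : spectralRadius ℂ T ≤ 1)
    (hlam : ‖lam‖ = 1) (hz : T z = lam • z) {s : ℝ} (hs : 1 < s) :
    (1 / (s - 1)) • L.absVal z ≤ L.realOp (resolvent T (s : ℂ)) (L.absVal z) := by
  refine hasSum_le (fun n => ?_) ((hasSum_inv_pow_succ hs).smul_const (L.absVal z))
    (hasSum_realOp_resolvent (L := L) hrad hs _)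
  exact smul_le_smul_of_nonneg_left (hT.absVal_le_realOp_pow hlam hz n).2 (by positivity)

end ComplexBanachLattice

/-! ### Growth of the resolvent and the powers of the eigenvalue -/

namespace ComplexBanachLattice

variable {X E : Type*} [NormedAddCommGroup X] [Lattice X]
    [IsOrderedAddMonoid X] [HasSolidNorm X] [NormedSpace ℝ X] [IsOrderedModule ℝ X]
    [CompleteSpace X] [NormedAddCommGroup E] [NormedSpace ℂ E] [CompleteSpace E]
    {L : ComplexBanachLattice X E} {T : E →L[ℂ] E}

/-- The resolvent identity gives `R(t) R(s) = R(s) R(t) ≤ (s - t)⁻¹ R(t)` on the positive cone, for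
`1 < t < s`. -/
theorem IsPositive.realOp_resolvent_comp_le (hT : L.IsPositive T)
    (hrad : spectralRadius ℂ T ≤ 1) {s t : ℝ} (ht : 1 < t) (hts : t < s) {x : X} (hx : 0 ≤ x) :
    L.realOp (resolvent T (t : ℂ)) (L.realOp (resolvent T (s : ℂ)) x) ≤
        (s - t)⁻¹ • L.realOp (resolvent T (t : ℂ)) x ∧
      L.realOp (resolvent T (s : ℂ)) (L.realOp (resolvent T (t : ℂ)) x) ≤
        (s - t)⁻¹ • L.realOp (resolvent T (t : ℂ)) x := by
  have mem : ∀ q : ℝ, 1 < q → (q : ℂ) ∈ resolventSet ℂ T := fun q hq =>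
    spectrum.mem_resolventSet_of_spectralRadius_lt
      (hrad.trans_lt (by exact_mod_cast one_lt_norm_ofReal hq))
  have hRs := hT.resolvent_ofReal hrad (ht.trans hts)
  have hRt := hT.resolvent_ofReal hrad ht
  have h0 : 0 < s - t := sub_pos.2 hts
  have key : ∀ S : E →L[ℂ] E, ((s : ℂ) - t) • S =
      resolvent T (t : ℂ) - resolvent T (s : ℂ) →
      L.realOp S x ≤ (s - t)⁻¹ • L.realOp (resolvent T (t : ℂ)) x := by
    intro S hS
    have h1 : (s - t) • L.realOp S x =
        L.realOp (resolvent T (t : ℂ)) x - L.realOp (resolvent T (s : ℂ)) x := by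
      rw [realOp_apply, realOp_apply, realOp_apply, ← re_sub, ← sub_apply,
        ← hS, ← re_real_smul, ← Complex.coe_smul]
      push_cast
      rfl
    have h2 : (s - t) • L.realOp S x ≤ L.realOp (resolvent T (t : ℂ)) x :=
      h1.trans_le (sub_le_self _ (hRs.realOp_nonneg hx))
    have h3 := smul_le_smul_of_nonneg_left h2 (inv_nonneg.2 h0.le)
    rwa [inv_smul_smul₀ h0.ne'] at h3
  constructor
  · rw [← hRs.realOp_mul_apply]
    exact key _ (smul_resolvent_mul_resolvent (mem s (ht.trans hts)) (mem t ht))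
  · rw [← hRt.realOp_mul_apply]
    refine key _ ?_
    rw [← neg_sub (t : ℂ), neg_smul,
      smul_resolvent_mul_resolvent (mem t ht) (mem s (ht.trans hts)), neg_sub]

/-- Outside the spectrum the resolvent stays bounded, so that `(r n - 1) R(r n μ, T)` vanishes in
the limit. -/
theorem tendsto_smul_absVal_resolvent {μ : ℂ} (hμ : μ ∉ spectrum ℂ T) (w : E) {r : ℕ → ℝ}
    (hr : Tendsto r atTop (𝓝 1)) :
    Tendsto (fun n => (r n - 1) • L.absVal (resolvent T ((r n : ℂ) * μ) w)) atTop (𝓝 0) := by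
  have hc : ContinuousAt (resolvent T) μ :=
    (spectrum.hasDerivAt_resolvent_const_left (spectrum.notMem_iff.1 hμ)).continuousAt
  have h1 : Tendsto (fun n => (r n : ℂ) * μ) atTop (𝓝 μ) := by
    simpa using ((Complex.continuous_ofReal.tendsto 1).comp hr).mul_const μ
  have h2 : Tendsto (fun n => ‖resolvent T ((r n : ℂ) * μ) w‖) atTop (𝓝 ‖resolvent T μ w‖) :=
    ((ContinuousLinearMap.apply ℂ E w).continuous.tendsto _ |>.comp (hc.tendsto.comp h1)).norm
  refine squeeze_zero_norm (a := fun n => |r n - 1| * ‖resolvent T ((r n : ℂ) * μ) w‖)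
    (fun n => by rw [norm_smul, norm_absVal, Real.norm_eq_abs]) ?_
  have h3 : Tendsto (fun n => |r n - 1|) atTop (𝓝 0) := by
    simpa using (hr.sub_const 1).abs
  simpa using h3.mul h2

/-- If `(r n - 1) R(r n, T) u` were bounded, applying `(r n - 1) R(r n, T)` to the estimate `hKu`
at `r m` and letting `m → ∞` would bound `(K + 1 / 2) ‖(r n - 1) R(r n, T) u‖` by `K` times the
supremum of these norms, which is positive by `hlow`. -/
theorem not_isBigO_one_div (hT : L.IsPositive T) (hrad : spectralRadius ℂ T ≤ 1) {u : X}
    (hu : 0 ≤ u) {r : ℕ → ℝ} (hr1 : ∀ n, 1 < r n) (hr : Tendsto r atTop (𝓝 1))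
    {K : ℝ} (hK : 0 ≤ K) {g : ℕ → X} (hg : Tendsto g atTop (𝓝 0))
    (hlow : ∀ n, 1 / (r n - 1) ≤ ‖L.realOp (resolvent T (r n : ℂ)) u‖)
    (hKu : ∀ n, (K + 1 / 2) • u ≤
      g n + (K * (r n - 1)) • L.realOp (resolvent T (r n : ℂ)) u) :
    ¬ (fun n => ‖L.realOp (resolvent T (r n : ℂ)) u‖) =O[atTop] fun n => 1 / (r n - 1) := by
  intro hO
  set R : ℕ → X →L[ℝ] X := fun n => L.realOp (resolvent T (r n : ℂ)) with hR
  set p : ℕ → ℝ := fun n => (r n - 1) * ‖R n u‖ with hp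
  have hpos : ∀ n, 0 < r n - 1 := fun n => sub_pos.2 (hr1 n)
  have hp1 : ∀ n, 1 ≤ p n := fun n => by
    have h := mul_le_mul_of_nonneg_left (hlow n) (hpos n).le
    rwa [mul_one_div_cancel (hpos n).ne'] at h
  obtain ⟨M, hM⟩ := hO.bound
  obtain ⟨N, hN⟩ := eventually_atTop.1 hM
  have hpM : ∀ n, N ≤ n → p n ≤ M := fun n hn => by
    have h := hN n hn
    rw [norm_norm, Real.norm_of_nonneg (one_div_pos.2 (hpos n)).le, mul_one_div,
      le_div_iff₀ (hpos n)] at h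
    exact (mul_comm _ _).trans_le h
  have hbdd : BddAbove (Set.range fun n => p (n + N)) :=
    ⟨M, by rintro _ ⟨n, rfl⟩; exact hpM _ (Nat.le_add_left _ _)⟩
  -- `p` is only bounded from `N` on, hence the shift in the supremum.
  set c := ⨆ n, p (n + N) with hc
  have hpc : ∀ n, N ≤ n → p n ≤ c := fun n hn => by
    have h := le_ciSup hbdd (n - N)
    rwa [Nat.sub_add_cancel hn] at h
  have hc1 : 1 ≤ c := (hp1 N).trans (hpc N le_rfl)
  have key : ∀ n, N ≤ n → (K + 1 / 2) * p n ≤ K * c := by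
    intro n hn
    have hRn := hT.resolvent_ofReal hrad (hr1 n)
    have hlim : Tendsto (fun m => (r n - 1) * (‖R n‖ * ‖g m‖ + K * (r n - r m)⁻¹ * c)) atTop
        (𝓝 ((r n - 1) * (‖R n‖ * ‖(0 : X)‖ + K * (r n - 1)⁻¹ * c))) :=
      ((hg.norm.const_mul _).add ((((hr.const_sub _).inv₀ (hpos n).ne').const_mul K).mul_const c)
        ).const_mul _
    -- Once `m → ∞`, the term `‖R n‖ * ‖g m‖` disappears although `‖R n‖` has no bound in `n`.
    have hval : (r n - 1) * (‖R n‖ * ‖(0 : X)‖ + K * (r n - 1)⁻¹ * c) = K * c := by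
      have := (hpos n).ne'
      rw [norm_zero]
      field_simp
      ring
    rw [hval] at hlim
    refine ge_of_tendsto hlim ?_
    filter_upwards [hr.eventually (gt_mem_nhds (hr1 n)), eventually_ge_atTop N] with m hm hmN
    have h1 := hRn.realOp_mono (hKu m)
    rw [map_smul, map_add, map_smul] at h1
    have h2 := (hT.realOp_resolvent_comp_le hrad (hr1 m) hm hu).2
    have h3 : (K + 1 / 2) • R n u ≤
        R n (g m) + (K * (r m - 1)) • (r n - r m)⁻¹ • R m u :=
      h1.trans (add_le_add_right
        (smul_le_smul_of_nonneg_left h2 (mul_nonneg hK (hpos m).le)) _)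
    have h4 := norm_le_norm_of_nonneg_of_le
      (smul_nonneg (by positivity) (hRn.realOp_nonneg hu)) h3
    have h5 : ‖R n (g m) + (K * (r m - 1)) • (r n - r m)⁻¹ • R m u‖ ≤
        ‖R n‖ * ‖g m‖ + K * (r n - r m)⁻¹ * p m := by
      refine (norm_add_le _ _).trans (add_le_add ((R n).le_opNorm _) (le_of_eq ?_))
      rw [norm_smul, norm_smul, Real.norm_of_nonneg (mul_nonneg hK (hpos m).le),
        Real.norm_of_nonneg (inv_nonneg.2 (sub_pos.2 hm).le)]
      ring
    have h6 : K * (r n - r m)⁻¹ * p m ≤ K * (r n - r m)⁻¹ * c :=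
      mul_le_mul_of_nonneg_left (hpc m hmN)
        (mul_nonneg hK (inv_nonneg.2 (sub_pos.2 hm).le))
    rw [norm_smul, Real.norm_of_nonneg (by positivity)] at h4
    have h7 := mul_le_mul_of_nonneg_left (h4.trans (h5.trans (add_le_add_right h6 _)))
      (hpos n).le
    calc (K + 1 / 2) * p n = (r n - 1) * ((K + 1 / 2) * ‖R n u‖) := by rw [hp]; ring
      _ ≤ _ := h7
  have hcle : c ≤ K * c / (K + 1 / 2) := ciSup_le fun n => by
    rw [le_div_iff₀ (by positivity), mul_comm]
    exact key _ (Nat.le_add_left _ _)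
  rw [le_div_iff₀ (by positivity)] at hcle
  linarith

/-- If the norm of the resolvent grew no faster than its value at `u`, then applying `R(r m, T)` to
the estimate `hKu` at `r n` would bound the norm of the error term by a multiple of
`‖g n‖ ‖R(r m, T) u‖`. Dividing by `‖R(r m, T) u‖`, the limits `m → ∞` and then `n → ∞` give
`K + 1 / 2 ≤ K`. -/
theorem not_norm_resolvent_isBigO (hT : L.IsPositive T) (hrad : spectralRadius ℂ T ≤ 1) {u : X}
    (hu : 0 ≤ u) {r : ℕ → ℝ} (hr1 : ∀ n, 1 < r n) (hr : Tendsto r atTop (𝓝 1))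
    {K : ℝ} (hK : 0 ≤ K) {g : ℕ → X} (hg : Tendsto g atTop (𝓝 0))
    (hlow : ∀ n, 1 / (r n - 1) ≤ ‖L.realOp (resolvent T (r n : ℂ)) u‖)
    (hKu : ∀ n, (K + 1 / 2) • u ≤
      g n + (K * (r n - 1)) • L.realOp (resolvent T (r n : ℂ)) u) :
    ¬ (fun n => ‖resolvent T (r n : ℂ)‖) =O[atTop]
      fun n => ‖L.realOp (resolvent T (r n : ℂ)) u‖ := by
  intro hO
  set R : ℕ → X →L[ℝ] X := fun n => L.realOp (resolvent T (r n : ℂ)) with hR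
  have hpos : ∀ n, 0 < r n - 1 := fun n => sub_pos.2 (hr1 n)
  obtain ⟨M, hM⟩ := hO.bound
  have key : ∀ n, K + 1 / 2 ≤ M * ‖g n‖ + K := by
    intro n
    have hlim : Tendsto (fun m => M * ‖g n‖ + K * (r n - 1) * (r n - r m)⁻¹) atTop
        (𝓝 (M * ‖g n‖ + K * (r n - 1) * (r n - 1)⁻¹)) :=
      (((hr.const_sub _).inv₀ (hpos n).ne').const_mul _).const_add _
    rw [mul_inv_cancel_right₀ (hpos n).ne'] at hlim
    refine ge_of_tendsto hlim ?_
    filter_upwards [hr.eventually (gt_mem_nhds (hr1 n)), hM] with m hm hmM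
    rw [norm_norm, norm_norm] at hmM
    have hRm := hT.resolvent_ofReal hrad (hr1 m)
    have hRu : 0 < ‖R m u‖ := (one_div_pos.2 (hpos m)).trans_le (hlow m)
    have h1 := hRm.realOp_mono (hKu n)
    rw [map_smul, map_add, map_smul] at h1
    have h2 := (hT.realOp_resolvent_comp_le hrad (hr1 m) hm hu).1
    have h3 : (K + 1 / 2) • R m u ≤
        R m (g n) + (K * (r n - 1)) • (r n - r m)⁻¹ • R m u :=
      h1.trans (add_le_add_right
        (smul_le_smul_of_nonneg_left h2 (mul_nonneg hK (hpos n).le)) _)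
    have h4 := norm_le_norm_of_nonneg_of_le
      (smul_nonneg (by positivity) (hRm.realOp_nonneg hu)) h3
    have h5 : ‖R m (g n) + (K * (r n - 1)) • (r n - r m)⁻¹ • R m u‖ ≤
        M * ‖R m u‖ * ‖g n‖ + K * (r n - 1) * (r n - r m)⁻¹ * ‖R m u‖ := by
      refine (norm_add_le _ _).trans (add_le_add ?_ (le_of_eq ?_))
      · rw [← hRm.norm_apply_ofReal]
        refine (ContinuousLinearMap.le_opNorm _ _).trans ?_
        rw [norm_ofReal]
        exact mul_le_mul_of_nonneg_right hmM (norm_nonneg _)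
      · rw [norm_smul, norm_smul, Real.norm_of_nonneg (mul_nonneg hK (hpos n).le),
          Real.norm_of_nonneg (inv_nonneg.2 (sub_pos.2 hm).le)]
        ring
    rw [norm_smul, Real.norm_of_nonneg (by positivity)] at h4
    refine le_of_mul_le_mul_right ((h4.trans h5).trans (le_of_eq ?_)) hRu
    ring
  have hlim : Tendsto (fun n => M * ‖g n‖ + K) atTop (𝓝 (M * ‖(0 : X)‖ + K)) :=
    (hg.norm.const_mul M).add_const K
  have h := ge_of_tendsto' hlim key
  rw [norm_zero] at h
  linarith

end ComplexBanachLattice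

theorem theorem1p1 {X E : Type*}
    [NormedAddCommGroup X] [Lattice X] [IsOrderedAddMonoid X] [HasSolidNorm X]
    [NormedSpace ℝ X] [IsOrderedModule ℝ X] [CompleteSpace X]
    [NormedAddCommGroup E] [NormedSpace ℂ E] [CompleteSpace E]
    (L : ComplexBanachLattice X E)
    (T : E →L[ℂ] E) (hT : L.IsPositive T) (hrad : spectralRadius ℂ T = 1)
    (lam : ℂ) (hlam : lam ∈ peripheralSpectrum T)
    (z : E) (hz : T z = lam • z) (hz1 : ‖z‖ = 1)
    (r : ℕ → ℝ) (hr1 : ∀ n, 1 < r n) (hranti : Antitone r) (hrlim : Tendsto r atTop (𝓝 1)) :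
    (∀ n, 1 / (r n - 1) ≤ ‖resolvent T (r n : ℂ) (L.modulus z)‖ ∧
      ‖resolvent T (r n : ℂ) (L.modulus z)‖ ≤ ‖resolvent T (r n : ℂ)‖) ∧
    ((fun n => ‖resolvent T (r n : ℂ) (L.modulus z)‖) =Θ[atTop] (fun n => 1 / (r n - 1)) →
      ∀ k : ℤ, lam ^ k ∈ spectrum ℂ T) ∧
    ((fun n => ‖resolvent T (r n : ℂ) (L.modulus z)‖) =Θ[atTop]
        (fun n => ‖resolvent T (r n : ℂ)‖) →
      ∀ k : ℤ, lam ^ k ∈ spectrum ℂ T) := by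
  have hlam1 : ‖lam‖ = 1 := by
    have h := hlam.2
    rw [hrad] at h
    have h1 : ‖lam‖₊ = 1 := by exact_mod_cast h
    rw [← coe_nnnorm, h1, NNReal.coe_one]
  have hu := L.absVal_nonneg z
  have hR : ∀ n, ‖resolvent T (r n : ℂ) (L.modulus z)‖ =
      ‖L.realOp (resolvent T (r n : ℂ)) (L.absVal z)‖ := fun n => by
    rw [L.modulus_eq, (hT.resolvent_ofReal hrad.le (hr1 n)).norm_apply_ofReal]
  have hlow : ∀ n, 1 / (r n - 1) ≤ ‖L.realOp (resolvent T (r n : ℂ)) (L.absVal z)‖ := fun n => by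
    have hpos : 0 ≤ 1 / (r n - 1) := (one_div_pos.2 (sub_pos.2 (hr1 n))).le
    have h := norm_le_norm_of_nonneg_of_le (smul_nonneg hpos hu)
      (hT.one_div_smul_absVal_le hrad.le hlam1 hz (hr1 n))
    rwa [norm_smul, L.norm_absVal, hz1, mul_one, Real.norm_of_nonneg hpos] at h
  simp only [hR]
  refine ⟨fun n => ⟨hlow n, ?_⟩, fun hΘ k => ?_, fun hΘ k => ?_⟩
  · rw [← hR]
    refine (ContinuousLinearMap.le_opNorm _ _).trans (le_of_eq ?_)
    rw [L.modulus_eq, L.norm_ofReal, L.norm_absVal, hz1, mul_one]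
  all_goals
    by_contra hk
    obtain ⟨K, hK, w, hw⟩ :=
      ComplexBanachLattice.exists_smul_absVal_le hT hrad.le hlam1 hz k
    have hg := ComplexBanachLattice.tendsto_smul_absVal_resolvent (L := L) hk w hrlim
  · exact ComplexBanachLattice.not_isBigO_one_div hT hrad.le hu hr1 hrlim hK hg hlow
      (fun n => hw (r n) (hr1 n)) hΘ.1
  · exact ComplexBanachLattice.not_norm_resolvent_isBigO hT hrad.le hu hr1 hrlim hK hg hlow
      (fun n => hw (r n) (hr1 n)) hΘ.2
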